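/- Let $A,B\in M_n(\mathbb Z)$ be matrices with $\det A\neq 0$ and $\det B\ne 0$. Put $$G_A=\{A^{-k}\mathbf x \mid \mathbf x\in\mathbb Z^n,\ k\in\mathbb Z\}\subseteq\mathbb Q^n,$$ and define $G_B$ likewise. Let $h_A\in\mathbb Z[t]$ be the characteristic polynomial of $A$. For a prime $p$ let $t_p(A)$ be the multiplicity of $0$ as a root of the reduction of $h_A$ modulo $p$, and let $\mathcal P'(A)$ be the set of primes $p$ dividing $\det A$ such that $h_A\not\equiv t^n \pmod p$. Assume that $h_A$ is irreducible in $\mathbb Z[t]$ and that there is a prime $p\in\mathcal P'(A)$ with $\gcd(n,t_p(A))=1$. Let $K\subset\overline{\mathbb Q}$ be a finite extension of $\mathbb Q$ that contains all eigenvalues of $A$ and of $B$, and let $\mathcal O_K$ be its ring of integers. If $T\in GL_n(\mathbb Q)$ satisfies $T(G_A)=G_B$, then there exist an eigenvector $\mathbf u\in K^n$ of $A$ with eigenvalue $\lambda\in\mathcal O_K$ and an eigenvector $\mathbf v\in K^n$ of $B$ with eigenvalue $\mu\in\mathcal O_K$ such that $T(\mathbf u)=\mathbf v$, and $\lambda$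 and $\mu$ have the same prime ideal divisors in $\mathcal O_K$; that is, for every nonzero prime ideal $\mathfrak p$ of $\mathcal O_K$, $\mathfrak p\mid(\lambda)$ if and only if $\mathfrak p\mid(\mu)$. -/

import Mathlib

open scoped Matrix NumberField

/-- The subset (in fact subgroup, for non-singular `A`)
`G_A = { A⁻ᵏ x | x ∈ ℤⁿ, k ∈ ℤ }` of `ℚⁿ`. -/
def solenoidGroup {n : ℕ} (A : Matrix (Fin n) (Fin n) ℤ) : Set (Fin n → ℚ) :=
  {y | ∃ (k : ℤ) (x : Fin n → ℤ),
    y = ((A.map (Int.cast : ℤ → ℚ)) ^ (-k)) *ᵥ (fun i => (x i : ℚ))}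

/-- The reduction modulo `p` of the characteristic polynomial `h_A ∈ ℤ[t]`. -/
noncomputable def charpolyMod {n : ℕ} (A : Matrix (Fin n) (Fin n) ℤ) (p : ℕ) :
    Polynomial (ZMod p) :=
  A.charpoly.map (Int.castRingHom (ZMod p))

/-- `t_p(A)`: the multiplicity of zero as a root of `h_A` modulo `p`. -/
noncomputable def zeroMultiplicity {n : ℕ} (A : Matrix (Fin n) (Fin n) ℤ) (p : ℕ) : ℕ :=
  (charpolyMod A p).rootMultiplicity 0

/-- `𝒫(A)`: the prime divisors of `det A`. -/
def detPrimes {n : ℕ} (A : Matrix (Fin n) (Fin n) ℤ) : Set ℕ :=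
  {p | p.Prime ∧ (p : ℤ) ∣ A.det}

/-- `𝒫'(A)`: the primes `p ∈ 𝒫(A)` for which `h_A` is not congruent to `xⁿ` modulo `p`. -/
def properDetPrimes {n : ℕ} (A : Matrix (Fin n) (Fin n) ℤ) : Set ℕ :=
  {p | p ∈ detPrimes A ∧ charpolyMod A p ≠ Polynomial.X ^ n}

/-! Put `M = T⁻¹BT`, which maps `G_A` into itself. The crux is that `M` commutes with `A`. Since
`h_A` is irreducible, `M` is then a polynomial `f(A)`, so `T` sends an eigenvector of `A` for `λ` to
an eigenvector of `B` for `μ = f(λ)`.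

Both commutation and the comparison of primes rest on boundedness of row vectors. If `φA = λφ`, then
`φ·(A⁻ᵏx) = λ⁻ᵏ(φ·x)`, so `φ` is bounded on `G_A` at a prime `P` iff `P ∤ λ`
(`Valuation.mem_boundedRows_solenoidGroup_iff`). As `T` carries `G_A` onto `G_B`, `φ` is bounded on
`G_A` iff `φT⁻¹`, an eigenrow of `B` for `μ`, is bounded on `G_B`; hence `λ` and `μ` have the same
prime divisors.

For commutation, work in a splitting field of `h_A` with a prime `P` above `p`. For each Galois
automorphism `σ`, the rows bounded on `G_A` for the valuation pulled back along `σ` form a subspace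
stable under `A` and `M`, spanned by the eigenrows whose eigenvalue `λᵢ` satisfies `σλᵢ ∉ P`.
Exactly `t_p(A)` of the `n` roots lie in `P`. Coprimality and transitivity of the Galois action make
these subspaces separate the eigenrows (`MulAction.eq_of_forall_smul_mem_imp`), so every eigenrow of
`A` is one of `M`. -/

/-! ### Separating points by translates of a set -/

/-- If the sets `g⁻¹ U` of a transitive action on a set of `m` points separate points only up to
a preorder, then the classes of that preorder have a common size dividing `m` and `|U|`; when these
are coprime the preorder is equality. -/
theorem MulAction.eq_of_forall_smul_mem_imp {G R : Type*} [Group G] [Fintype R] [MulAction G R]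
    [MulAction.IsPretransitive G R] (U : Finset R)
    (hU : Nat.gcd (Fintype.card R) U.card = 1) {i j : R}
    (hij : ∀ g : G, g • i ∈ U → g • j ∈ U) : i = j := by
  classical
  let J : R → Finset R := fun i => Finset.univ.filter fun j => ∀ g : G, g • i ∈ U → g • j ∈ U
  have memJ : ∀ {i j}, j ∈ J i ↔ ∀ g : G, g • i ∈ U → g • j ∈ U := by simp [J]
  have self_mem : ∀ i, i ∈ J i := fun i => memJ.2 fun _ h => h
  have subset : ∀ {i j}, j ∈ J i → J j ⊆ J i := fun {i j} h k hk =>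
    memJ.2 fun g hg => memJ.1 hk g (memJ.1 h g hg)
  have card_le : ∀ i j, (J i).card ≤ (J j).card := by
    intro i j
    obtain ⟨g, rfl⟩ := MulAction.exists_smul_eq G i j
    refine Finset.card_le_card_of_injOn (fun k => g • k) (fun k hk => ?_)
      (MulAction.injective g).injOn
    refine memJ.2 fun h hh => ?_
    have := memJ.1 hk (h * g)
    simp only [mul_smul] at this
    exact this hh
  have card_eq : ∀ i j, (J i).card = (J j).card := fun i j => (card_le i j).antisymm (card_le j i)
  -- Equal cardinalities turn inclusion into equality, so the preorder is symmetric and the sets `J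
  -- i` partition `R`.
  have eq_of_mem : ∀ {i j}, j ∈ J i → J j = J i := fun {i j} h =>
    Finset.eq_of_subset_of_card_le (subset h) (card_le i j)
  have dvd : ∀ S : Finset R, (∀ s ∈ S, J s ⊆ S) → (J i).card ∣ S.card := by
    intro S hS
    rw [Finset.card_eq_sum_card_image J S]
    refine Finset.dvd_sum fun b hb => ?_
    obtain ⟨s, hs, rfl⟩ := Finset.mem_image.1 hb
    have : S.filter (fun a => J a = J s) = J s := by
      ext a
      rw [Finset.mem_filter]
      exact ⟨fun h => h.2 ▸ self_mem a, fun h => ⟨hS s hs h, eq_of_mem h⟩⟩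
    rw [this, card_eq i s]
  have h1 : (J i).card ∣ 1 := by
    rw [← hU]
    refine Nat.dvd_gcd (dvd Finset.univ fun _ _ => Finset.subset_univ _) (dvd U fun s hs k hk => ?_)
    have := memJ.1 hk 1
    simp only [one_smul] at this
    exact this hs
  have h2 := Nat.dvd_one.1 h1
  exact (Finset.card_le_one.1 h2.le) i (self_mem i) j (memJ.2 hij)

/-! ### Invariant subspaces and eigenbases -/

-- The polynomial `q` vanishes at every eigenvalue except `l j`, so `q(a)` is, up to a nonzero
-- scalar, the projection onto the line of `b j`; being a polynomial in `a`, it preserves `W`.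
open Polynomial in
theorem Module.Basis.mem_of_repr_ne_zero_of_invariant {F V ι : Type*} [Field F] [AddCommGroup V]
    [Module F V] [Fintype ι] (b : Module.Basis ι F V) {a : Module.End F V} {l : ι → F}
    (hl : Function.Injective l) (hab : ∀ i, a (b i) = l i • b i) {W : Submodule F V}
    (hW : ∀ x ∈ W, a x ∈ W) {x : V} (hx : x ∈ W) {j : ι} (hj : b.repr x j ≠ 0) : b j ∈ W := by
  classical
  let q : F[X] := ∏ k ∈ Finset.univ.erase j, (X - C (l k))
  have hq : ∀ k, aeval a q (b k) = q.eval (l k) • b k := fun k =>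
    Module.End.aeval_apply_of_hasEigenvector
      ⟨Module.End.mem_eigenspace_iff.2 (hab k), b.ne_zero k⟩
  have hqj : q.eval (l j) ≠ 0 := by
    simp only [q, eval_prod, eval_sub, eval_X, eval_C]
    refine Finset.prod_ne_zero_iff.2 fun k hk => sub_ne_zero.2 fun h => ?_
    exact (Finset.mem_erase.1 hk).1 (hl h).symm
  have hqk : ∀ k ≠ j, q.eval (l k) = 0 := fun k hk => by
    simp only [q, eval_prod, eval_sub, eval_X, eval_C]
    exact Finset.prod_eq_zero (Finset.mem_erase.2 ⟨hk, Finset.mem_univ k⟩) (sub_self _)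
  have hqx : aeval a q x ∈ W := by
    have hpow : ∀ m : ℕ, (a ^ m) x ∈ W := by
      intro m
      induction m with
      | zero => simpa using hx
      | succ m ih => rw [pow_succ']; exact hW _ ih
    rw [aeval_eq_sum_range, LinearMap.sum_apply]
    exact Submodule.sum_mem _ fun m _ => Submodule.smul_mem _ _ (hpow m)
  have key : aeval a q x = (b.repr x j * q.eval (l j)) • b j := by
    conv_lhs => rw [← b.sum_repr x]
    rw [map_sum, Finset.sum_eq_single j]
    · rw [map_smul, hq, smul_smul]
    · intro k _ hk
      rw [map_smul, hq, hqk k hk, zero_smul, smul_zero]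
    · simp
  rw [key] at hqx
  exact (Submodule.smul_mem_iff _ (mul_ne_zero hj hqj)).1 hqx

/-- Two endomorphisms that preserve a family of subspaces separating the members of an eigenbasis
of the first one commute. -/
theorem Module.Basis.commute_of_invariant_submodules {F V ι κ : Type*} [Field F] [AddCommGroup V]
    [Module F V] [Fintype ι] (b : Module.Basis ι F V) {a c : Module.End F V} {l : ι → F}
    (hl : Function.Injective l) (hab : ∀ i, a (b i) = l i • b i) (W : κ → Submodule F V)
    (haW : ∀ k, ∀ x ∈ W k, a x ∈ W k) (hcW : ∀ k, ∀ x ∈ W k, c x ∈ W k)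
    (hsep : ∀ i j, (∀ k, b i ∈ W k → b j ∈ W k) → i = j) : Commute a c := by
  classical
  -- If `b j` occurs in `c (b i)`, then `b j` lies in every `W k` containing `b i`, and separation
  -- forces `j = i`.
  have hc : ∀ i, c (b i) = b.repr (c (b i)) i • b i := by
    intro i
    conv_lhs => rw [← b.sum_repr (c (b i))]
    refine Finset.sum_eq_single i (fun j _ hji => ?_) (by simp)
    by_contra h
    refine hji (hsep i j fun k hk => ?_).symm
    refine b.mem_of_repr_ne_zero_of_invariant hl hab (haW k) (hcW k _ hk) (j := j) ?_
    exact fun h0 => h (by rw [h0, zero_smul])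
  refine b.ext fun i => ?_
  obtain ⟨m, hm⟩ : ∃ m : F, c (b i) = m • b i := ⟨_, hc i⟩
  rw [Module.End.mul_apply, Module.End.mul_apply, hm, hab, map_smul, map_smul, hm, hab, smul_comm]

/-! ### Rows bounded on `G_A` -/

/-- The row vectors over a valued field that take values of bounded valuation on a set of rational
column vectors. -/
def Valuation.boundedRows {n : ℕ} {F Γ₀ : Type*} [Field F] [Algebra ℚ F]
    [LinearOrderedCommGroupWithZero Γ₀] (v : Valuation F Γ₀) (S : Set (Fin n → ℚ)) :
    Submodule F (Fin n → F) where
  carrier := {φ | ∃ γ, ∀ y ∈ S, v (φ ⬝ᵥ (algebraMap ℚ F ∘ y)) ≤ γ}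
  add_mem' := by
    rintro φ ψ ⟨γ, hγ⟩ ⟨δ, hδ⟩
    refine ⟨max γ δ, fun y hy => ?_⟩
    rw [add_dotProduct]
    exact (v.map_add _ _).trans (max_le_max (hγ y hy) (hδ y hy))
  zero_mem' := ⟨0, fun y _ => by simp⟩
  smul_mem' := by
    rintro c φ ⟨γ, hγ⟩
    refine ⟨v c * γ, fun y hy => ?_⟩
    rw [smul_dotProduct, smul_eq_mul, map_mul]
    exact mul_le_mul_right (hγ y hy) _

theorem vecMul_zpow_of_eigenvector {n : ℕ} {F : Type*} [Field F] {M : Matrix (Fin n) (Fin n) F} (hM : IsUnit M.det)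
    {φ : Fin n → F} {l : F} (hl : l ≠ 0) (h : φ ᵥ* M = l • φ) (k : ℤ) :
    φ ᵥ* M ^ k = l ^ k • φ := by
  have h' : φ ᵥ* M⁻¹ = l⁻¹ • φ := by
    have := congrArg (· ᵥ* M⁻¹) h
    simp only [Matrix.vecMul_vecMul, Matrix.mul_nonsing_inv _ hM, Matrix.vecMul_one,
      Matrix.smul_vecMul] at this
    rw [this, smul_smul, inv_mul_cancel₀ hl, one_smul, ← this]
  induction k with
  | zero => simp
  | succ k ih =>
    rw [Matrix.zpow_add_one hM, ← Matrix.vecMul_vecMul, ih, Matrix.smul_vecMul, h, smul_smul,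
      zpow_add_one₀ hl]
  | pred k ih =>
    rw [Matrix.zpow_sub_one hM, ← Matrix.vecMul_vecMul, ih, Matrix.smul_vecMul, h', smul_smul,
      zpow_sub_one₀ hl]

theorem Valuation.map_intCast_le_one {F Γ₀ : Type*} [Field F] [LinearOrderedCommGroupWithZero Γ₀]
    (v : Valuation F Γ₀) (m : ℤ) : v (m : F) ≤ 1 := by
  have : (m : F) ∈ v.integer := intCast_mem _ m
  exact this

section

variable {n : ℕ} {F Γ₀ : Type*} [Field F] [Algebra ℚ F] [LinearOrderedCommGroupWithZero Γ₀]

theorem Valuation.mem_boundedRows {v : Valuation F Γ₀} {S : Set (Fin n → ℚ)} {φ : Fin n → F} :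
    φ ∈ v.boundedRows S ↔ ∃ γ, ∀ y ∈ S, v (φ ⬝ᵥ (algebraMap ℚ F ∘ y)) ≤ γ :=
  Iff.rfl

theorem algebraMap_comp_mulVec (M : Matrix (Fin n) (Fin n) ℚ) (y : Fin n → ℚ) :
    algebraMap ℚ F ∘ (M *ᵥ y) = M.map (algebraMap ℚ F) *ᵥ (algebraMap ℚ F ∘ y) := by
  ext i
  exact RingHom.map_mulVec (algebraMap ℚ F) M y i

theorem vecMul_dotProduct_algebraMap (φ : Fin n → F) (M : Matrix (Fin n) (Fin n) ℚ)
    (y : Fin n → ℚ) :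
    (φ ᵥ* M.map (algebraMap ℚ F)) ⬝ᵥ (algebraMap ℚ F ∘ y)
      = φ ⬝ᵥ (algebraMap ℚ F ∘ (M *ᵥ y)) := by
  rw [algebraMap_comp_mulVec, Matrix.dotProduct_mulVec]

theorem Valuation.vecMul_mem_boundedRows_iff (v : Valuation F Γ₀) (S : Set (Fin n → ℚ))
    (M : Matrix (Fin n) (Fin n) ℚ) (φ : Fin n → F) :
    φ ᵥ* M.map (algebraMap ℚ F) ∈ v.boundedRows S ↔ φ ∈ v.boundedRows ((M *ᵥ ·) '' S) := by
  simp only [mem_boundedRows, Set.forall_mem_image, vecMul_dotProduct_algebraMap]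

theorem Valuation.vecMul_mem_boundedRows (v : Valuation F Γ₀) {S : Set (Fin n → ℚ)}
    {M : Matrix (Fin n) (Fin n) ℚ} (hM : ∀ y ∈ S, M *ᵥ y ∈ S) {φ : Fin n → F}
    (hφ : φ ∈ v.boundedRows S) : φ ᵥ* M.map (algebraMap ℚ F) ∈ v.boundedRows S := by
  rw [vecMul_mem_boundedRows_iff]
  obtain ⟨γ, hγ⟩ := hφ
  refine ⟨γ, Set.forall_mem_image.2 fun y hy => hγ _ (hM y hy)⟩

theorem isUnit_det_map_intCast {A : Matrix (Fin n) (Fin n) ℤ} (hA : A.det ≠ 0) :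
    IsUnit (A.map (Int.cast : ℤ → ℚ)).det := by
  have := (Int.castRingHom ℚ).map_det A
  rw [isUnit_iff_ne_zero]
  change ((Int.castRingHom ℚ).mapMatrix A).det ≠ 0
  rw [← this]
  simpa using hA

theorem mulVec_mem_solenoidGroup {A : Matrix (Fin n) (Fin n) ℤ} (hA : A.det ≠ 0)
    {y : Fin n → ℚ} (hy : y ∈ solenoidGroup A) :
    A.map (Int.cast : ℤ → ℚ) *ᵥ y ∈ solenoidGroup A := by
  obtain ⟨k, x, rfl⟩ := hy
  refine ⟨k - 1, x, ?_⟩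
  rw [Matrix.mulVec_mulVec, ← Matrix.zpow_one_add (isUnit_det_map_intCast hA)]
  congr 2
  ring

theorem map_algebraMap_zpow (M : Matrix (Fin n) (Fin n) ℚ) (hM : IsUnit M.det) (k : ℤ) :
    (M ^ k).map (algebraMap ℚ F) = (M.map (algebraMap ℚ F)) ^ k := by
  lift M to (Matrix (Fin n) (Fin n) ℚ)ˣ using (Matrix.isUnit_iff_isUnit_det M).2 hM
  let f := Units.map ((algebraMap ℚ F).mapMatrix (m := Fin n)).toMonoidHom
  have h1 := Matrix.coe_units_zpow (f M) k
  rw [← map_zpow] at h1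
  rw [← Matrix.coe_units_zpow]
  exact h1

theorem map_intCast_map_algebraMap (A : Matrix (Fin n) (Fin n) ℤ) :
    (A.map (Int.cast : ℤ → ℚ)).map (algebraMap ℚ F) = A.map (Int.cast : ℤ → F) := by
  ext; simp

theorem isUnit_det_map_algebraMap {M : Matrix (Fin n) (Fin n) ℚ} (hM : IsUnit M.det) :
    IsUnit (M.map (algebraMap ℚ F)).det := by
  have := (algebraMap ℚ F).map_det M
  change IsUnit ((algebraMap ℚ F).mapMatrix M).det
  rw [← this]
  exact hM.map _

theorem ne_zero_of_eigenvector {A : Matrix (Fin n) (Fin n) ℤ} (hA : A.det ≠ 0) {φ : Fin n → F}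
    (hφ : φ ≠ 0) {l : F} (h : φ ᵥ* A.map (Int.cast : ℤ → F) = l • φ) : l ≠ 0 := by
  rintro rfl
  have hu := isUnit_det_map_algebraMap (F := F) (isUnit_det_map_intCast hA)
  rw [map_intCast_map_algebraMap] at hu
  refine hφ (Matrix.eq_zero_of_vecMul_eq_zero hu.ne_zero ?_)
  simpa using h

/-- A left eigenvector of `A` is bounded on `G_A` exactly when its eigenvalue is a unit for the
valuation. -/
theorem Valuation.mem_boundedRows_solenoidGroup_iff [MulArchimedean Γ₀] (v : Valuation F Γ₀)
    {A : Matrix (Fin n) (Fin n) ℤ} (hA : A.det ≠ 0) {φ : Fin n → F} (hφ : φ ≠ 0) {l : F}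
    (h : φ ᵥ* A.map (Int.cast : ℤ → F) = l • φ) (hl : v l ≤ 1) :
    φ ∈ v.boundedRows (solenoidGroup A) ↔ v l = 1 := by
  have hl0 := ne_zero_of_eigenvector hA hφ h
  have hu := isUnit_det_map_intCast hA
  have hu' := isUnit_det_map_algebraMap (F := F) hu
  rw [map_intCast_map_algebraMap] at hu'
  have hval : ∀ (k : ℤ) (x : Fin n → ℤ), φ ⬝ᵥ (algebraMap ℚ F ∘
      ((A.map (Int.cast : ℤ → ℚ)) ^ (-k) *ᵥ fun i => (x i : ℚ)))
      = l ^ (-k) * ∑ i, φ i * (x i : F) := by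
    intro k x
    rw [← vecMul_dotProduct_algebraMap, map_algebraMap_zpow _ hu, map_intCast_map_algebraMap,
      vecMul_zpow_of_eigenvector hu' hl0 h, smul_dotProduct, smul_eq_mul]
    simp [dotProduct]
  constructor
  · rintro ⟨γ, hγ⟩
    by_contra hne
    have hlt : v l < 1 := lt_of_le_of_ne hl hne
    obtain ⟨i, hi⟩ := Function.ne_iff.1 hφ
    have hvi : v (φ i) ≠ 0 := v.ne_zero_iff.2 hi
    have hvl : v l ≠ 0 := v.ne_zero_iff.2 hl0
    obtain ⟨k, hk⟩ := MulArchimedean.arch (γ / v (φ i)) ((one_lt_inv₀ (zero_lt_iff.2 hvl)).2 hlt)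
    -- The test vectors are `A⁻ᵏ⁻¹eᵢ` with `φ i ≠ 0`. The Archimedean bound at `k` is not strict, so
    -- one further factor `(v l)⁻¹ > 1` is needed for the contradiction.
    have hb := hγ _ ⟨k + 1, Pi.single i 1, rfl⟩
    rw [hval] at hb
    have hs : ∑ j, φ j * ((Pi.single i (1 : ℤ) : Fin n → ℤ) j : F) = φ i := by
      rw [Finset.sum_eq_single i] <;> simp +contextual
    rw [hs, map_mul, map_zpow₀] at hb
    have h1 : γ ≤ (v l)⁻¹ ^ k * v (φ i) := by
      rwa [div_le_iff₀ (zero_lt_iff.2 hvi)] at hk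
    have h2 : (v l) ^ (-((k : ℤ) + 1)) = (v l)⁻¹ ^ k * (v l)⁻¹ := by
      rw [zpow_neg, ← inv_zpow, zpow_add_one₀ (inv_ne_zero hvl), zpow_natCast]
    have h3 := hb.trans h1
    rw [h2] at h3
    have h4 := le_of_mul_le_mul_right h3 (zero_lt_iff.2 hvi)
    have h5 : (v l)⁻¹ ≤ 1 :=
      le_of_mul_le_mul_left (h4.trans_eq (mul_one _).symm)
        (zero_lt_iff.2 (pow_ne_zero _ (inv_ne_zero hvl)))
    exact absurd ((one_lt_inv₀ (zero_lt_iff.2 hvl)).2 hlt) (not_lt.2 h5)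
  · intro h1
    refine ⟨Finset.univ.sup fun i => v (φ i), ?_⟩
    rintro _ ⟨k, x, rfl⟩
    rw [hval, map_mul, map_zpow₀, h1, one_zpow, one_mul]
    refine v.map_sum_le fun i _ => ?_
    rw [map_mul]
    exact (mul_le_of_le_one_right' (v.map_intCast_le_one (x i))).trans
      (Finset.le_sup (f := fun i => v (φ i)) (Finset.mem_univ i))

end

/-! ### Roots of `h_A` modulo a prime, and the Galois action -/

open Polynomial in
/-- The multiplicity of the root `0` of `h` modulo `p` is the number of roots of `h` in a prime
above `p`. -/
theorem Polynomial.rootMultiplicity_zero_map_zmod {R ι : Type*} [CommRing R] [Fintype ι]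
    {h : ℤ[X]} {r : ι → R} (hr : h.map (algebraMap ℤ R) = ∏ i, (X - C (r i))) {p : ℕ}
    (hp : p.Prime) {P : Ideal R} [P.IsPrime] (hpP : (p : R) ∈ P) [DecidablePred fun i => r i ∈ P] :
    (h.map (Int.castRingHom (ZMod p))).rootMultiplicity 0
      = (Finset.univ.filter fun i => r i ∈ P).card := by
  classical
  have : Fact p.Prime := ⟨hp⟩
  have : CharP (R ⧸ P) p := (CharP.charP_iff_prime_eq_zero hp).2 <| by
    rw [← map_natCast (Ideal.Quotient.mk P)]
    exact Ideal.Quotient.eq_zero_iff_mem.2 hpP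
  -- The multiplicity may be computed in the domain `R ⧸ P`, which contains `ZMod p` and over which
  -- `h` splits with roots the residues of the `r i`.
  let θ : ZMod p →+* R ⧸ P := ZMod.castHom dvd_rfl (R ⧸ P)
  have hmap : (h.map (Int.castRingHom (ZMod p))).map θ
      = ∏ i, (X - C (Ideal.Quotient.mk P (r i))) := by
    rw [Polynomial.map_map, RingHom.ext_int (θ.comp (Int.castRingHom (ZMod p)))
      ((Ideal.Quotient.mk P).comp (algebraMap ℤ R)), ← Polynomial.map_map, hr, Polynomial.map_prod]
    simp
  rw [eq_rootMultiplicity_map (f := θ) θ.injective, map_zero, hmap, ← count_roots,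
    Finset.prod_eq_multiset_prod,
    ← Function.comp_def (fun a => X - C a) (fun i => Ideal.Quotient.mk P (r i)),
    ← Multiset.map_map, roots_multiset_prod_X_sub_C, Multiset.count_map, Finset.card_def, Finset.filter_val]
  refine congrArg _ (Multiset.filter_congr fun i _ => ?_)
  rw [eq_comm, Ideal.Quotient.eq_zero_iff_mem]

open Polynomial in
theorem Polynomial.Splits.map_eq_prod_rootSet {F L : Type*} [Field F] [Field L] [Algebra F L]
    {f : F[X]} (hf : (f.map (algebraMap F L)).Splits) (hm : f.Monic) (hs : f.Separable) :
    f.map (algebraMap F L) = ∏ i : f.rootSet L, (X - C (i : L)) := by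
  classical
  conv_lhs => rw [hf.eq_prod_roots_of_monic (hm.map _)]
  have hnd := nodup_roots (hs.map (f := algebraMap F L))
  have h1 : (f.map (algebraMap F L)).roots = ((f.map (algebraMap F L)).roots.toFinset).val := by
    rw [Multiset.toFinset_val, hnd.dedup]
  rw [h1, ← Finset.prod_eq_multiset_prod]
  exact (Finset.prod_coe_sort (f.map (algebraMap F L)).roots.toFinset (fun x => X - C x)).symm

-- All roots have the same minimal polynomial, namely `f` made monic, and conjugate elements of a
-- normal extension differ by an automorphism.
open Polynomial in
theorem Polynomial.isPretransitive_rootSet {F L : Type*} [Field F] [Field L] [Algebra F L]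
    [Normal F L] {f : F[X]} (hf : Irreducible f) :
    MulAction.IsPretransitive (L ≃ₐ[F] L) (f.rootSet L) := by
  refine ⟨fun x y => ?_⟩
  have key : ∀ z : f.rootSet L, minpoly F (z : L) = f * C f.leadingCoeff⁻¹ := fun z =>
    (minpoly.eq_of_irreducible hf (mem_rootSet.1 z.2).2).symm
  have : IsConjRoot F (y : L) (x : L) := (key y).trans (key x).symm
  obtain ⟨σ, hσ⟩ := isConjRoot_iff_exists_algEquiv.1 this
  exact ⟨σ, Subtype.ext hσ⟩

theorem Matrix.exists_vecMul_eq_smul {n : ℕ} {F : Type*} [Field F] {M : Matrix (Fin n) (Fin n) F}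
    {l : F} (hl : M.charpoly.IsRoot l) : ∃ φ : Fin n → F, φ ≠ 0 ∧ φ ᵥ* M = l • φ := by
  rw [← Matrix.charpoly_transpose, ← Matrix.charpoly_toLin',
    ← Module.End.hasEigenvalue_iff_isRoot_charpoly] at hl
  obtain ⟨φ, hφ⟩ := hl.exists_hasEigenvector
  refine ⟨φ, hφ.2, ?_⟩
  have := hφ.apply_eq_smul
  rwa [Matrix.toLin'_apply, Matrix.mulVec_transpose] at this

theorem charpoly_map_intCast {n : ℕ} (A : Matrix (Fin n) (Fin n) ℤ) (F : Type*) [CommRing F] :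
    (A.map (Int.cast : ℤ → F)).charpoly = A.charpoly.map (algebraMap ℤ F) :=
  Matrix.charpoly_map A (Int.castRingHom F)

theorem irreducible_charpoly_map_rat {n : ℕ} {A : Matrix (Fin n) (Fin n) ℤ}
    (hirr : Irreducible A.charpoly) : Irreducible (A.map (Int.cast : ℤ → ℚ)).charpoly := by
  rw [charpoly_map_intCast]
  exact (A.charpoly_monic.irreducible_iff_irreducible_map_fraction_map).1 hirr

theorem pos_of_irreducible_charpoly {n : ℕ} {F : Type*} [CommRing F] [Nontrivial F]
    {M : Matrix (Fin n) (Fin n) F} (hirr : Irreducible M.charpoly) : 0 < n := by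
  rcases Nat.eq_zero_or_pos n with rfl | h
  · exact absurd (by rw [Matrix.charpoly, Matrix.det_isEmpty]; exact isUnit_one) hirr.not_isUnit
  · exact h

/-! ### Endomorphisms of `G_A` commute with `A` -/

open Polynomial in
/-- An integral matrix with irreducible characteristic polynomial `h`, for which the multiplicity of
the root `0` of `h` modulo some prime is coprime to the degree, commutes with every endomorphism
of `G_A`. -/
theorem commute_of_mapsTo_solenoidGroup_of_splits {n : ℕ} {A : Matrix (Fin n) (Fin n) ℤ}
    (hA : A.det ≠ 0) (hirr : Irreducible A.charpoly) {p : ℕ} (hp : p.Prime)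
    (hgcd : Nat.gcd n (zeroMultiplicity A p) = 1)
    (L : Type*) [Field L] [Algebra ℚ L] [NumberField L] [Normal ℚ L]
    (hsplit : ((A.map (Int.cast : ℤ → ℚ)).charpoly.map (algebraMap ℚ L)).Splits)
    {M : Matrix (Fin n) (Fin n) ℚ} (hM : ∀ y ∈ solenoidGroup A, M *ᵥ y ∈ solenoidGroup A) :
    Commute (A.map (Int.cast : ℤ → ℚ)) M := by
  classical
  set f := (A.map (Int.cast : ℤ → ℚ)).charpoly with hf
  have hfirr : Irreducible f := irreducible_charpoly_map_rat hirr
  have hfm : f.Monic := Matrix.charpoly_monic _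
  have hfL : f.map (algebraMap ℚ L) = A.charpoly.map (algebraMap ℤ L) := by
    rw [hf, charpoly_map_intCast, Polynomial.map_map]
    congr 1
    exact RingHom.ext_int _ _
  have := isPretransitive_rootSet (L := L) hfirr
  have hcard : Fintype.card (f.rootSet L) = n := by
    rw [card_rootSet_eq_natDegree hfirr.separable hsplit, hf, Matrix.charpoly_natDegree_eq_dim,
      Fintype.card_fin]
  -- a prime above `p`
  obtain ⟨P, hPmax, hpP⟩ : ∃ P : Ideal (𝓞 L), P.IsMaximal ∧ (p : 𝓞 L) ∈ P := by
    have : (Ideal.span {(p : ℤ)}).IsMaximal :=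
      PrincipalIdealRing.isMaximal_of_irreducible (Nat.prime_iff_prime_int.1 hp).irreducible
    obtain ⟨Q, hQ, hQ'⟩ := Ideal.exists_ideal_over_maximal_of_isIntegral (S := 𝓞 L)
      (Ideal.span {(p : ℤ)}) (by
        rw [(RingHom.injective_iff_ker_eq_bot _).1
          (FaithfulSMul.algebraMap_injective ℤ (𝓞 L))]; exact bot_le)
    refine ⟨Q, hQ, ?_⟩
    have h1 : (p : ℤ) ∈ Q.comap (algebraMap ℤ (𝓞 L)) := hQ' ▸ Ideal.mem_span_singleton_self _
    simpa using h1
  have hPbot : P ≠ ⊥ := by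
    rintro rfl
    rw [Ideal.mem_bot] at hpP
    exact hp.ne_zero (by exact_mod_cast hpP)
  let w : IsDedekindDomain.HeightOneSpectrum (𝓞 L) := ⟨P, hPmax.isPrime, hPbot⟩
  have hroot : ∀ i : f.rootSet L, (f.map (algebraMap ℚ L)).IsRoot (i : L) := fun i => by
    rw [IsRoot.def, eval_map_algebraMap]
    exact (mem_rootSet.1 i.2).2
  have hint : ∀ i : f.rootSet L, IsIntegral ℤ (i : L) := fun i => by
    refine ⟨A.charpoly, A.charpoly_monic, ?_⟩
    have := hroot i
    rwa [hfL, IsRoot.def, eval_map] at this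
  let r : f.rootSet L → 𝓞 L := fun i => ⟨i, hint i⟩
  have hprod : A.charpoly.map (algebraMap ℤ (𝓞 L)) = ∏ i, (X - C (r i)) := by
    apply Polynomial.map_injective (algebraMap (𝓞 L) L) (FaithfulSMul.algebraMap_injective _ _)
    rw [Polynomial.map_map, ← IsScalarTower.algebraMap_eq, ← hfL,
      hsplit.map_eq_prod_rootSet hfm hfirr.separable, Polynomial.map_prod]
    refine Finset.prod_congr rfl fun i _ => ?_
    rw [Polynomial.map_sub, map_X, map_C]
    rfl
  have ht : zeroMultiplicity A p = (Finset.univ.filter fun i => r i ∈ P).card :=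
    rootMultiplicity_zero_map_zmod hprod hp hpP
  have hval : ∀ i : f.rootSet L, w.valuation L (i : L) = 1 ↔ r i ∉ P := fun i => by
    have h1 : w.valuation L (r i : L) < 1 ↔ r i ∈ P := w.valuation_lt_one_iff_mem (r i)
    have h2 : w.valuation L (r i : L) ≤ 1 := w.valuation_le_one (r i)
    rw [← h1, not_lt]
    exact ⟨fun h => h.ge, fun h => h2.antisymm h⟩
  have hle : ∀ i : f.rootSet L, w.valuation L (i : L) ≤ 1 := fun i => w.valuation_le_one (r i)
  let U : Finset (f.rootSet L) := Finset.univ.filter fun i => r i ∉ P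
  have hU : Nat.gcd (Fintype.card (f.rootSet L)) U.card = 1 := by
    have hadd := Finset.card_filter_add_card_filter_not (s := Finset.univ) (fun i => r i ∈ P)
    rw [← ht, Finset.card_univ, hcard] at hadd
    change zeroMultiplicity A p + U.card = n at hadd
    rw [hcard]
    -- `U` has `n - t_p(A)` elements, and `gcd(n, n - t) = gcd(n, t)`.
    have h1 : Nat.Coprime (zeroMultiplicity A p + U.card) (zeroMultiplicity A p) := by
      rw [hadd]; exact hgcd
    rw [← hadd]
    simp only [Nat.coprime_self_add_left] at h1
    change Nat.Coprime _ _
    simpa using h1.symm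
  -- an eigenbasis of row vectors
  have hAL : (A.map (Int.cast : ℤ → ℚ)).map (algebraMap ℚ L) = A.map (Int.cast : ℤ → L) :=
    map_intCast_map_algebraMap A
  have hev : ∀ i : f.rootSet L, ∃ φ : Fin n → L,
      φ ≠ 0 ∧ φ ᵥ* A.map (Int.cast : ℤ → L) = (i : L) • φ := fun i => by
    refine Matrix.exists_vecMul_eq_smul ?_
    rw [charpoly_map_intCast, ← hfL]
    exact hroot i
  choose φ hφ0 hφ using hev
  have hli : LinearIndependent L φ :=
    Module.End.eigenvectors_linearIndependent' (A.map (Int.cast : ℤ → L)).vecMulLinear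
      (fun i : f.rootSet L => (i : L)) Subtype.val_injective φ
      fun i => ⟨Module.End.mem_eigenspace_iff.2 (hφ i), hφ0 i⟩
  have : Nonempty (f.rootSet L) := Fintype.card_pos_iff.1 (by
    rw [hcard]; exact pos_of_irreducible_charpoly hirr)
  let b := basisOfLinearIndependentOfCardEqFinrank hli (by
    rw [hcard, Module.finrank_fin_fun])
  have hb : ∀ i, b i = φ i := fun i => by simp [b]
  -- Pulling back along `σ` tests `σλᵢ` rather than `λᵢ` against `P`, while `G_A`, being rational,
  -- is unaffected.
  let v : (L ≃ₐ[ℚ] L) → Valuation L (WithZero (Multiplicative ℤ)) := fun σ =>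
    (w.valuation L).comap (σ : L →+* L)
  have hmem : ∀ (σ : L ≃ₐ[ℚ] L) i, φ i ∈ (v σ).boundedRows (solenoidGroup A) ↔ σ • i ∈ U := by
    intro σ i
    rw [(v σ).mem_boundedRows_solenoidGroup_iff hA (hφ0 i) (hφ i) (hle (σ • i))]
    simp only [U, Finset.mem_filter, Finset.mem_univ, true_and]
    exact hval (σ • i)
  have hcomm := b.commute_of_invariant_submodules (a := (A.map (Int.cast : ℤ → L)).vecMulLinear)
    (c := (M.map (algebraMap ℚ L)).vecMulLinear) (l := fun i : f.rootSet L => (i : L)) Subtype.val_injective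
    (fun i => by rw [hb]; exact hφ i)
    (fun σ => (v σ).boundedRows (solenoidGroup A))
    (fun σ x hx => by
      rw [Matrix.vecMulLinear_apply, ← hAL]
      exact (v σ).vecMul_mem_boundedRows (fun y hy => mulVec_mem_solenoidGroup hA hy) hx)
    (fun σ x hx => (v σ).vecMul_mem_boundedRows hM hx)
    (fun i j hij => MulAction.eq_of_forall_smul_mem_imp (G := L ≃ₐ[ℚ] L) U hU fun σ hσ => by
      have := hij σ
      rw [hb, hb, hmem, hmem] at this
      exact this hσ)
  rw [← hAL] at hcomm
  have hinj : Function.Injective ((algebraMap ℚ L).mapMatrix (m := Fin n)) :=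
    Matrix.map_injective (algebraMap ℚ L).injective
  refine hinj ?_
  rw [map_mul, map_mul]
  refine Matrix.ext_iff_vecMul.2 fun x => ?_
  have := congrArg (fun g => g x) hcomm.eq
  simp only [Module.End.mul_apply, Matrix.vecMulLinear_apply, Matrix.vecMul_vecMul] at this
  exact this.symm

theorem commute_of_mapsTo_solenoidGroup {n : ℕ} {A : Matrix (Fin n) (Fin n) ℤ}
    (hA : A.det ≠ 0) (hirr : Irreducible A.charpoly) {p : ℕ} (hp : p.Prime)
    (hgcd : Nat.gcd n (zeroMultiplicity A p) = 1)
    {M : Matrix (Fin n) (Fin n) ℚ} (hM : ∀ y ∈ solenoidGroup A, M *ᵥ y ∈ solenoidGroup A) :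
    Commute (A.map (Int.cast : ℤ → ℚ)) M := by
  let f := (A.map (Int.cast : ℤ → ℚ)).charpoly
  obtain ⟨L, _, _, _⟩ : ∃ (L : Type) (_ : Field L) (_ : Algebra ℚ L),
      Polynomial.IsSplittingField ℚ L f :=
    ⟨f.SplittingField, _, _, Polynomial.IsSplittingField.splittingField f⟩
  have : FiniteDimensional ℚ L := Polynomial.IsSplittingField.finiteDimensional L f
  have : NumberField L := NumberField.of_module_finite ℚ L
  have : Normal ℚ L := Normal.of_isSplittingField f
  exact commute_of_mapsTo_solenoidGroup_of_splits hA hirr hp hgcd L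
    (Polynomial.IsSplittingField.splits L f) hM

/-! ### The commutant of `A` and its eigenvectors -/

open Polynomial in
/-- The commutant of a matrix with irreducible characteristic polynomial consists of polynomials
in that matrix. -/
theorem Matrix.exists_aeval_eq_of_commute {n : ℕ} {F : Type*} [Field F]
    {M N : Matrix (Fin n) (Fin n) F} (hn : 0 < n) (hirr : Irreducible M.charpoly)
    (h : Commute M N) : ∃ f : F[X], N = aeval M f := by
  let e : Fin n → F := Pi.single ⟨0, hn⟩ 1
  have he : e ≠ 0 := by simp [e]
  -- Every nonzero vector is cyclic: a nonzero `q` of degree below `n` is coprime to the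
  -- characteristic polynomial, so `q(M)` is invertible, and a dimension count gives surjectivity.
  let Φ : degreeLT F n →ₗ[F] (Fin n → F) :=
    { toFun := fun q => aeval M (q : F[X]) *ᵥ e
      map_add' := fun q s => by simp [Matrix.add_mulVec]
      map_smul' := fun c q => by simp [Matrix.smul_mulVec] }
  have hinj : Function.Injective Φ := by
    rw [injective_iff_map_eq_zero]
    rintro ⟨q, hq⟩ hq0
    by_contra hne
    have hq_ne : q ≠ 0 := fun h0 => hne (Subtype.ext h0)
    have hcop : IsCoprime M.charpoly q := by
      refine hirr.coprime_iff_not_dvd.2 fun hdvd => ?_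
      have h1 := degree_le_of_dvd hdvd hq_ne
      rw [Matrix.charpoly_degree_eq_dim, Fintype.card_fin] at h1
      exact absurd (mem_degreeLT.1 hq) (not_lt.2 h1)
    obtain ⟨a, b, hab⟩ := hcop
    have h2 := congrArg (aeval M) hab
    rw [map_add, map_mul, map_mul, Matrix.aeval_self_charpoly, mul_zero, zero_add, map_one] at h2
    apply he
    rw [← Matrix.one_mulVec e, ← h2, ← Matrix.mulVec_mulVec]
    have h3 : aeval M q *ᵥ e = 0 := hq0
    rw [h3, Matrix.mulVec_zero]
  have : Module.Finite F (degreeLT F n) := Module.Finite.of_basis (degreeLT.basis F n)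
  have hsurj : Function.Surjective Φ := by
    refine (LinearMap.injective_iff_surjective_of_finrank_eq_finrank ?_).1 hinj
    rw [Module.finrank_eq_card_basis (degreeLT.basis F n), Module.finrank_fin_fun, Fintype.card_fin]
  obtain ⟨⟨f, _⟩, hf⟩ := hsurj (N *ᵥ e)
  -- `N` and `f(M)` agree on the cyclic vector `e` and both commute with every `q(M)`, so they agree
  -- everywhere.
  refine ⟨f, Matrix.ext_iff_mulVec.2 fun x => ?_⟩
  obtain ⟨⟨q, _⟩, rfl⟩ := hsurj x
  change aeval M f *ᵥ e = N *ᵥ e at hf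
  change N *ᵥ (aeval M q *ᵥ e) = aeval M f *ᵥ (aeval M q *ᵥ e)
  have hq : Commute (aeval M q) N := by
    refine Polynomial.induction_on' (motive := fun q => Commute (aeval M q) N) q
      (fun a b ha hb => by rw [map_add]; exact ha.add_left hb) fun k a => ?_
    rw [aeval_monomial]
    exact Commute.mul_left (Algebra.commutes a N) (h.pow_left k)
  rw [Matrix.mulVec_mulVec, Matrix.mulVec_mulVec, ← hq.eq, ← Matrix.mulVec_mulVec, ← hf,
    Matrix.mulVec_mulVec, ← map_mul, ← map_mul, mul_comm]

section

open Polynomial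

variable {n : ℕ} {R F : Type*} [Field R] [Field F] [Algebra R F]

theorem Matrix.aeval_mulVec_of_mulVec_eq_smul {M : Matrix (Fin n) (Fin n) F} {u : Fin n → F} {l : F}
    (h : M *ᵥ u = l • u) (f : R[X]) : aeval M f *ᵥ u = aeval l f • u := by
  have hpow : ∀ k : ℕ, M ^ k *ᵥ u = l ^ k • u := fun k => by
    induction k with
    | zero => simp
    | succ k ih => rw [pow_succ', ← Matrix.mulVec_mulVec, ih, Matrix.mulVec_smul, h, smul_smul,
        pow_succ]
  refine Polynomial.induction_on' (motive := fun f => aeval M f *ᵥ u = aeval l f • u) f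
    (fun a b ha hb => by rw [map_add, map_add, Matrix.add_mulVec, ha, hb, add_smul]) fun k a => ?_
  rw [aeval_monomial, aeval_monomial, ← Algebra.smul_def, ← Algebra.smul_def, Matrix.smul_mulVec,
    hpow, smul_assoc]

theorem Matrix.vecMul_aeval_of_vecMul_eq_smul {M : Matrix (Fin n) (Fin n) F} {φ : Fin n → F} {l : F}
    (h : φ ᵥ* M = l • φ) (f : R[X]) : φ ᵥ* aeval M f = aeval l f • φ := by
  have hpow : ∀ k : ℕ, φ ᵥ* M ^ k = l ^ k • φ := fun k => by
    induction k with
    | zero => simp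
    | succ k ih => rw [pow_succ, ← Matrix.vecMul_vecMul, ih, Matrix.smul_vecMul, h, smul_smul,
        pow_succ]
  refine Polynomial.induction_on' (motive := fun f => φ ᵥ* aeval M f = aeval l f • φ) f
    (fun a b ha hb => by rw [map_add, map_add, Matrix.vecMul_add, ha, hb, add_smul]) fun k a => ?_
  rw [aeval_monomial, aeval_monomial, ← Algebra.smul_def, ← Algebra.smul_def, Matrix.vecMul_smul,
    hpow, smul_assoc]

theorem Matrix.map_algebraMap_aeval (M : Matrix (Fin n) (Fin n) R) (f : R[X]) :
    (aeval M f).map (algebraMap R F) = aeval (M.map (algebraMap R F)) f :=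
  (aeval_algHom_apply (Algebra.ofId R F).mapMatrix M f).symm

end

/-! ### Prime divisors of corresponding eigenvalues -/

/-- Intertwined left eigenvectors for `A` and `B = T A' T⁻¹` have eigenvalues with the same prime
divisors when `T` maps `G_A` onto `G_B`. -/
theorem dvd_span_iff_of_image_solenoidGroup {n : ℕ} {A B : Matrix (Fin n) (Fin n) ℤ}
    (hA : A.det ≠ 0) (hB : B.det ≠ 0) {T : Matrix (Fin n) (Fin n) ℚ}
    (hT : (T *ᵥ ·) '' solenoidGroup A = solenoidGroup B)
    {K : Type*} [Field K] [Algebra ℚ K] [NumberField K] {φ ψ : Fin n → K} {l m : 𝓞 K}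
    (hφ0 : φ ≠ 0) (hφ : φ ᵥ* A.map (Int.cast : ℤ → K) = (l : K) • φ)
    (hψ : ψ ᵥ* B.map (Int.cast : ℤ → K) = (m : K) • ψ)
    (hφψ : ψ ᵥ* T.map (algebraMap ℚ K) = φ) {P : Ideal (𝓞 K)} (hP : P.IsPrime) (hP0 : P ≠ ⊥) :
    P ∣ Ideal.span {l} ↔ P ∣ Ideal.span {m} := by
  have hψ0 : ψ ≠ 0 := by
    rintro rfl
    exact hφ0 (by rw [← hφψ, Matrix.zero_vecMul])
  let w : IsDedekindDomain.HeightOneSpectrum (𝓞 K) := ⟨P, hP, hP0⟩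
  have key : ∀ x : 𝓞 K, P ∣ Ideal.span {x} ↔ ¬ w.valuation K (x : K) = 1 := fun x => by
    have h1 : w.valuation K (x : K) < 1 ↔ x ∈ P := w.valuation_lt_one_iff_mem x
    have h2 : w.valuation K (x : K) ≤ 1 := w.valuation_le_one x
    rw [Ideal.dvd_span_singleton, ← h1]
    exact ⟨fun h => h.ne, fun h => lt_of_le_of_ne h2 h⟩
  rw [key, key, ← (w.valuation K).mem_boundedRows_solenoidGroup_iff hA hφ0 hφ (w.valuation_le_one l),
    ← (w.valuation K).mem_boundedRows_solenoidGroup_iff hB hψ0 hψ (w.valuation_le_one m), ← hT,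
    ← hφψ, Valuation.vecMul_mem_boundedRows_iff]

theorem isIntegral_of_isRoot_charpoly_map {n : ℕ} (A : Matrix (Fin n) (Fin n) ℤ) {K : Type*}
    [Field K] {l : K} (h : (A.map (Int.cast : ℤ → K)).charpoly.IsRoot l) : IsIntegral ℤ l := by
  refine ⟨A.charpoly, A.charpoly_monic, ?_⟩
  rwa [charpoly_map_intCast, Polynomial.IsRoot.def, Polynomial.eval_map] at h

theorem isRoot_charpoly_of_hasEigenvector {n : ℕ} {K : Type*} [Field K]
    {M : Matrix (Fin n) (Fin n) K} {l : K} {u : Fin n → K}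
    (h : Module.End.HasEigenvector (Matrix.toLin' M) l u) : M.charpoly.IsRoot l := by
  rw [← Matrix.charpoly_toLin', ← Module.End.hasEigenvalue_iff_isRoot_charpoly]
  exact Module.End.hasEigenvalue_of_hasEigenvector h

theorem exists_hasEigenvector_of_image_solenoidGroup {n : ℕ} (A B : Matrix (Fin n) (Fin n) ℤ)
    (hA : A.det ≠ 0) (hB : B.det ≠ 0)
    (hirr : Irreducible A.charpoly) {p : ℕ} (hp : p.Prime)
    (hgcd : Nat.gcd n (zeroMultiplicity A p) = 1)
    (K : Type*) [Field K] [Algebra ℚ K] [NumberField K] {l : K}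
    (hl : (A.map (Int.cast : ℤ → K)).charpoly.IsRoot l) (T : GL (Fin n) ℚ)
    (hT : (fun x : Fin n → ℚ => (T : Matrix (Fin n) (Fin n) ℚ) *ᵥ x) '' solenoidGroup A
      = solenoidGroup B) :
    ∃ (u v : Fin n → K) (lam mu : 𝓞 K),
      Module.End.HasEigenvector (Matrix.toLin' (A.map (Int.cast : ℤ → K))) (lam : K) u ∧
      Module.End.HasEigenvector (Matrix.toLin' (B.map (Int.cast : ℤ → K))) (mu : K) v ∧
      (T : Matrix (Fin n) (Fin n) ℚ).map (algebraMap ℚ K) *ᵥ u = v ∧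
      ∀ P : Ideal (𝓞 K), P.IsPrime → P ≠ ⊥ →
        (P ∣ Ideal.span {lam} ↔ P ∣ Ideal.span {mu}) := by
  let T' : Matrix (Fin n) (Fin n) ℚ := T
  let S : Matrix (Fin n) (Fin n) ℚ := (T⁻¹ : GL (Fin n) ℚ)
  have hTS : T' * S = 1 := T.mul_inv
  have hST : S * T' = 1 := T.inv_mul
  let M := S * B.map (Int.cast : ℤ → ℚ) * T'
  have hTM : T' * M = B.map (Int.cast : ℤ → ℚ) * T' := by
    simp only [M]
    rw [← mul_assoc, ← mul_assoc, hTS, one_mul]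
  have hMS : M * S = S * B.map (Int.cast : ℤ → ℚ) := by
    simp only [M]
    rw [mul_assoc, hTS, mul_one]
  have hM : ∀ y ∈ solenoidGroup A, M *ᵥ y ∈ solenoidGroup A := by
    intro y hy
    have h1 : T' *ᵥ y ∈ solenoidGroup B := hT ▸ ⟨y, hy, rfl⟩
    have h2 := mulVec_mem_solenoidGroup hB h1
    rw [← hT] at h2
    obtain ⟨z, hz, hz'⟩ := h2
    change T' *ᵥ z = _ at hz'
    have : M *ᵥ y = z := by
      have h3 := congrArg (S *ᵥ ·) hz'
      simp only [Matrix.mulVec_mulVec, hST, Matrix.one_mulVec] at h3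
      rw [h3, ← mul_assoc]
    rwa [this]
  have hcomm := commute_of_mapsTo_solenoidGroup hA hirr hp hgcd hM
  obtain ⟨f, hf⟩ := Matrix.exists_aeval_eq_of_commute (pos_of_irreducible_charpoly hirr)
    (irreducible_charpoly_map_rat hirr) hcomm
  have hMK : M.map (algebraMap ℚ K) = Polynomial.aeval (A.map (Int.cast : ℤ → K)) f := by
    rw [hf, Matrix.map_algebraMap_aeval, map_intCast_map_algebraMap]
  have hmapmul : ∀ X Y : Matrix (Fin n) (Fin n) ℚ,
      (X * Y).map (algebraMap ℚ K) = X.map (algebraMap ℚ K) * Y.map (algebraMap ℚ K) :=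
    fun X Y => Matrix.map_mul
  have hTMK := congrArg (fun X : Matrix (Fin n) (Fin n) ℚ => X.map (algebraMap ℚ K)) hTM
  have hMSK := congrArg (fun X : Matrix (Fin n) (Fin n) ℚ => X.map (algebraMap ℚ K)) hMS
  have hSTK := congrArg (fun X : Matrix (Fin n) (Fin n) ℚ => X.map (algebraMap ℚ K)) hST
  simp only [hmapmul, map_intCast_map_algebraMap, hMK] at hTMK hMSK hSTK
  rw [Matrix.map_one _ (map_zero _) (map_one _)] at hSTK
  obtain ⟨φ, hφ0, hφ⟩ := Matrix.exists_vecMul_eq_smul hl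
  obtain ⟨u, hu⟩ : ∃ u, Module.End.HasEigenvector (Matrix.toLin' (A.map (Int.cast : ℤ → K))) l u :=
    ((Module.End.hasEigenvalue_iff_isRoot_charpoly _ _).2
      (by rwa [Matrix.charpoly_toLin'])).exists_hasEigenvector
  have hu1 : A.map (Int.cast : ℤ → K) *ᵥ u = l • u := by
    simpa [Matrix.toLin'_apply] using hu.apply_eq_smul
  -- Because `M = f(A)`, the same `f(l)` is the eigenvalue of `B` on the column `Tu` and on the row
  -- `φT⁻¹`. The column gives the eigenvector sought, the row the comparison of primes.
  let m : K := Polynomial.aeval l f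
  have hv : Module.End.HasEigenvector (Matrix.toLin' (B.map (Int.cast : ℤ → K))) m
      (T'.map (algebraMap ℚ K) *ᵥ u) := by
    refine ⟨Module.End.mem_eigenspace_iff.2 ?_, fun h0 => hu.2 ?_⟩
    · rw [Matrix.toLin'_apply, Matrix.mulVec_mulVec, ← hTMK, ← Matrix.mulVec_mulVec,
        Matrix.aeval_mulVec_of_mulVec_eq_smul hu1, Matrix.mulVec_smul]
    · rw [← Matrix.one_mulVec u, ← hSTK, ← Matrix.mulVec_mulVec, h0, Matrix.mulVec_zero]
  have hψ : (φ ᵥ* S.map (algebraMap ℚ K)) ᵥ* B.map (Int.cast : ℤ → K)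
      = m • (φ ᵥ* S.map (algebraMap ℚ K)) := by
    rw [Matrix.vecMul_vecMul, ← hMSK, ← Matrix.vecMul_vecMul,
      Matrix.vecMul_aeval_of_vecMul_eq_smul hφ, Matrix.smul_vecMul]
  let lam : 𝓞 K := ⟨l, isIntegral_of_isRoot_charpoly_map A hl⟩
  let mu : 𝓞 K := ⟨m, isIntegral_of_isRoot_charpoly_map B (isRoot_charpoly_of_hasEigenvector hv)⟩
  refine ⟨u, _, lam, mu, hu, hv, rfl, fun P hP hP0 =>
    dvd_span_iff_of_image_solenoidGroup (l := lam) (m := mu) hA hB (T := T') hT hφ0 hφ hψ ?_ hP hP0⟩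
  rw [Matrix.vecMul_vecMul, hSTK, Matrix.vecMul_one]

theorem proposition5p7 {n : ℕ} (A B : Matrix (Fin n) (Fin n) ℤ)
    (hA : A.det ≠ 0) (hB : B.det ≠ 0)
    (hirr : Irreducible A.charpoly)
    (hp : ∃ p ∈ properDetPrimes A, Nat.gcd n (zeroMultiplicity A p) = 1)
    (K : IntermediateField ℚ (AlgebraicClosure ℚ)) [FiniteDimensional ℚ K]
    (hKA : ∀ α : AlgebraicClosure ℚ, Module.End.HasEigenvalue
      (Matrix.toLin' (A.map (Int.cast : ℤ → AlgebraicClosure ℚ))) α → α ∈ K)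
    (hKB : ∀ α : AlgebraicClosure ℚ, Module.End.HasEigenvalue
      (Matrix.toLin' (B.map (Int.cast : ℤ → AlgebraicClosure ℚ))) α → α ∈ K)
    (T : GL (Fin n) ℚ)
    (hT : (fun x : Fin n → ℚ => (T : Matrix (Fin n) (Fin n) ℚ) *ᵥ x) '' solenoidGroup A
      = solenoidGroup B) :
    ∃ (u v : Fin n → K) (lam mu : 𝓞 K),
      Module.End.HasEigenvector (Matrix.toLin' (A.map (Int.cast : ℤ → K))) (lam : K) u ∧
      Module.End.HasEigenvector (Matrix.toLin' (B.map (Int.cast : ℤ → K))) (mu : K) v ∧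
      (T : Matrix (Fin n) (Fin n) ℚ).map (algebraMap ℚ K) *ᵥ u = v ∧
      ∀ P : Ideal (𝓞 K), P.IsPrime → P ≠ ⊥ →
        (P ∣ Ideal.span {lam} ↔ P ∣ Ideal.span {mu}) := by
  obtain ⟨p, hpA, hgcd⟩ := hp
  have : NumberField K := NumberField.of_module_finite ℚ K
  have hn : 0 < n := pos_of_irreducible_charpoly hirr
  obtain ⟨α, hα⟩ := IsAlgClosed.exists_root
    (A.map (Int.cast : ℤ → AlgebraicClosure ℚ)).charpoly (by
      rw [Matrix.charpoly_degree_eq_dim, Fintype.card_fin]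
      exact_mod_cast hn.ne')
  have hαK : α ∈ K := hKA α ((Module.End.hasEigenvalue_iff_isRoot_charpoly _ _).2
    (by rwa [Matrix.charpoly_toLin']))
  have hl : (A.map (Int.cast : ℤ → K)).charpoly.IsRoot ⟨α, hαK⟩ := by
    refine Polynomial.IsRoot.of_map (f := algebraMap K (AlgebraicClosure ℚ)) ?_
      (algebraMap K (AlgebraicClosure ℚ)).injective
    rw [charpoly_map_intCast] at hα ⊢
    rw [Polynomial.map_map, RingHom.ext_int ((algebraMap K (AlgebraicClosure ℚ)).comp _)
      (algebraMap ℤ (AlgebraicClosure ℚ))]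
    exact hα
  exact exists_hasEigenvector_of_image_solenoidGroup A B hA hB hirr hpA.1.1 hgcd K hl T hT
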